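/- An overpartition of a nonnegative integer $m$ is a partition of $m$ in which the first occurrence of each part may be overlined (the empty partition being the only overpartition of $0$). Let $\overline{p}_3(n)$ be the number of overpartition triples of $n$, that is, of ordered triples $(\omega_1,\omega_2,\omega_3)$ of overpartitions such that the sum of all the parts of $\omega_1,\omega_2,\omega_3$ is $n$; in particular $\overline{p}_3(0)=1$. Let $r_7(n)$ be the number of representations of $n$ as a sum of seven squares, that is, the number of $(x_1,\dots,x_7)\in\mathbb{Z}^7$ with $x_1^2+\cdots+x_7^2=n$. Then for every integer $n\ge 0$, \[\overline{p}_3(11n)\equiv(-1)^n\, r_7(n)\pmod{11}.\] -/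

import Mathlib

/-- An overpartition of `n`: a partition of `n` in which the first occurrence of each part may be
overlined. It is given by the partition and the set of those part sizes whose first occurrence is
overlined. -/
structure Overpartition (n : ℕ) extends Nat.Partition n where
  /-- the part sizes whose first occurrence is overlined -/
  overlined : Finset ℕ
  overlined_subset : overlined ⊆ parts.toFinset

/-- An overpartition `k`-tuple of `n`: a `k`-tuple of overpartitions, of arbitrary numbers
`m₁, …, mₖ`, such that the sum of all the parts, `m₁ + ⋯ + mₖ`, equals `n`. -/
def OverpartitionTuple (k n : ℕ) : Type :=
  {ω : Fin k → (Σ m : ℕ, Overpartition m) // ∑ i, (ω i).1 = n}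

/-- The number of overpartition `k`-tuples of `n`. -/
noncomputable def overpartitionCount (k n : ℕ) : ℕ :=
  Nat.card (OverpartitionTuple k n)

/-- A representation of `n` as a sum of `k` squares of integers, where order and signs matter. -/
def SquaresRep (k n : ℕ) : Type :=
  {x : Fin k → ℤ // ∑ i, x i ^ 2 = (n : ℤ)}

/-- `r_k(n)`: the number of representations of `n` as a sum of `k` squares. -/
noncomputable def sumSquaresCount (k n : ℕ) : ℕ :=
  Nat.card (SquaresRep k n)

/-! The three counted types are finite, so that `Nat.card` is a genuine count. -/

instance Overpartition.instFinite (n : ℕ) : Finite (Overpartition n) := by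
  let f : Overpartition n → Nat.Partition n × {S // S ∈ (Finset.range (n + 1)).powerset} :=
    fun π => (π.toPartition, ⟨π.overlined, by
      rw [Finset.mem_powerset]
      intro a ha
      have h := Multiset.mem_toFinset.mp (π.overlined_subset ha)
      have h2 := π.toPartition.le_of_mem_parts h
      exact Finset.mem_range.mpr (by omega)⟩)
  refine Finite.of_injective f ?_
  rintro ⟨p, S, hS⟩ ⟨q, T, hT⟩ h
  simp only [f, Prod.mk.injEq, Subtype.mk.injEq] at h
  obtain ⟨rfl, rfl⟩ := h
  rfl

instance OverpartitionTuple.instFinite (k n : ℕ) : Finite (OverpartitionTuple k n) := by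
  let g : (Σ m : Fin (n + 1), Overpartition m) → (Σ m : ℕ, Overpartition m) :=
    fun x => ⟨x.1, x.2⟩
  have hfin : {ω : Fin k → (Σ m : ℕ, Overpartition m) | ∑ i, (ω i).1 = n}.Finite := by
    refine (Set.finite_range (fun (a : Fin k → (Σ m : Fin (n + 1), Overpartition m)) i =>
      g (a i))).subset ?_
    intro ω hω
    have hle : ∀ i, (ω i).1 < n + 1 := fun i => by
      have h := Finset.single_le_sum (f := fun i => (ω i).1) (fun _ _ => Nat.zero_le _)
        (Finset.mem_univ i)
      have h' : ∑ i, (ω i).1 = n := hω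
      omega
    exact ⟨fun i => ⟨⟨(ω i).1, hle i⟩, (ω i).2⟩, rfl⟩
  exact hfin.to_subtype

instance SquaresRep.instFinite (k n : ℕ) : Finite (SquaresRep k n) := by
  have hfin : {x : Fin k → ℤ | ∑ i, x i ^ 2 = (n : ℤ)}.Finite := by
    refine (Set.finite_Icc (fun _ : Fin k => -(n : ℤ)) (fun _ => (n : ℤ))).subset ?_
    intro x hx
    have hle : ∀ i, x i ^ 2 ≤ (n : ℤ) := fun i => by
      have h := Finset.single_le_sum (f := fun i => x i ^ 2) (fun _ _ => sq_nonneg _)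
        (Finset.mem_univ i)
      have h' : ∑ i, x i ^ 2 = (n : ℤ) := hx
      omega
    have h1 : ∀ i, -(n : ℤ) ≤ x i := fun i => by
      have h := Int.le_self_sq (-x i)
      have h' := hle i
      rw [neg_sq] at h
      omega
    have h2 : ∀ i, x i ≤ (n : ℤ) := fun i => (Int.le_self_sq (x i)).trans (hle i)
    exact ⟨h1, h2⟩
  exact hfin.to_subtype

/-! Let `P` be the generating function of overpartitions and `θ = ∑ (-1)^j q^(j^2)` over all
integers `j`. Gauss's identity `θ P = 1` (`thetaSeries_mul_overpartitionSeries`) gives `P^3 = θ^8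
P^11`, and modulo 11 Frobenius turns `P^11` into `P(q^11)`. Extracting the exponents divisible by 11
therefore leaves `P` times the same extraction applied to `θ^8`.

Jacobi's theorem (`thetaSeries_pow_eight`) expresses `θ^8` through the divisor sum `altCubeSum`.
Modulo a prime `p`, that sum takes the same value at `p * k` as at `k` (`altCubeSum_mul_modEq`), so
the extraction fixes `θ^8` modulo 11. The result is `θ^8 P = θ^7`, whose coefficients are the signed
counts of seven squares.

Jacobi's theorem reduces to `(1 + 16 A) P^8 = 1`, where `A` generates `altCubeSum`. Logarithmic
differentiation of the product for `P` turns this into a convolution identity between divisor sums,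
`sum_oddCodivisorSum_mul_altCubeSum`, proved by Liouville's elementary method. Gauss's identity
comes from a finite version proved by telescoping. -/

/-! ### Liouville's method and the convolution of divisor sums -/

/-- Twice the indicator function of the odd numbers. -/
def oddWeight (x : ℕ) : ℤ := 1 - (-1) ^ x

/-- Twice the sum of the divisors of `n` with odd codivisor. -/
def oddCodivisorSum (n : ℕ) : ℤ := ∑ p ∈ n.divisorsAntidiagonal, oddWeight p.2 * p.1

/-- The alternating sum of the cubes of the divisors of `n`. -/
def altCubeSum (n : ℕ) : ℤ := ∑ p ∈ n.divisorsAntidiagonal, (-1) ^ p.1 * (p.1 : ℤ) ^ 3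

/-- The quadruples `((a, x), (b, y))` of positive integers with `a * x + b * y = n`. -/
def quadruples (n : ℕ) : Finset ((ℕ × ℕ) × (ℕ × ℕ)) :=
  (((Finset.range (n + 1) ×ˢ Finset.range (n + 1)) ×ˢ
    (Finset.range (n + 1) ×ˢ Finset.range (n + 1)))).filter fun r =>
      0 < r.1.1 ∧ 0 < r.1.2 ∧ 0 < r.2.1 ∧ 0 < r.2.2 ∧ r.1.1 * r.1.2 + r.2.1 * r.2.2 = n

theorem mem_quadruples {n a x b y : ℕ} :
    ((a, x), (b, y)) ∈ quadruples n ↔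
      0 < a ∧ 0 < x ∧ 0 < b ∧ 0 < y ∧ a * x + b * y = n := by
  simp only [quadruples, Finset.mem_filter, Finset.mem_product, Finset.mem_range,
    and_iff_right_iff_imp]
  rintro ⟨ha, hx, hb, hy, rfl⟩
  refine ⟨⟨?_, ?_⟩, ?_, ?_⟩ <;> nlinarith

theorem sum_antidiagonal_divisorsAntidiagonal (n : ℕ) (f : ℕ × ℕ → ℕ × ℕ → ℤ) :
    ∑ i ∈ Finset.HasAntidiagonal.antidiagonal n, ∑ p ∈ i.1.divisorsAntidiagonal,
      ∑ q ∈ i.2.divisorsAntidiagonal, f p q = ∑ r ∈ quadruples n, f r.1 r.2 := by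
  simp_rw [← Finset.sum_product']
  rw [Finset.sum_sigma']
  refine Finset.sum_nbij' (fun z => z.2)
    (fun r => ⟨(r.1.1 * r.1.2, r.2.1 * r.2.2), r⟩) ?_ ?_ ?_ ?_ ?_
  · rintro ⟨⟨i, j⟩, ⟨a, x⟩, ⟨b, y⟩⟩ h
    simp only [Finset.mem_sigma, Finset.HasAntidiagonal.mem_antidiagonal, Finset.mem_product,
      Nat.mem_divisorsAntidiagonal] at h
    obtain ⟨rfl, ⟨rfl, h1⟩, rfl, h2⟩ := h
    simp only [ne_eq, mul_eq_zero, not_or, ← Nat.pos_iff_ne_zero] at h1 h2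
    exact mem_quadruples.2 ⟨h1.1, h1.2, h2.1, h2.2, rfl⟩
  · rintro ⟨⟨a, x⟩, ⟨b, y⟩⟩ h
    obtain ⟨ha, hx, hb, hy, h⟩ := mem_quadruples.1 h
    simp only [Finset.mem_sigma, Finset.HasAntidiagonal.mem_antidiagonal, Finset.mem_product,
      Nat.mem_divisorsAntidiagonal]
    exact ⟨h, ⟨trivial, by positivity⟩, trivial, by positivity⟩
  · rintro ⟨⟨i, j⟩, ⟨a, x⟩, ⟨b, y⟩⟩ h
    simp only [Finset.mem_sigma, Finset.HasAntidiagonal.mem_antidiagonal, Finset.mem_product,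
      Nat.mem_divisorsAntidiagonal] at h
    obtain ⟨rfl, ⟨rfl, h1⟩, rfl, h2⟩ := h
    rfl
  · intro r _
    rfl
  · intro z _
    rfl

/-- The function summed over the quadruples with `x ≠ y`. -/
def liouvilleSource (a b x y : ℕ) : ℤ :=
  oddWeight y * (-1) ^ a * ((a : ℤ) ^ 2 + 2 * a * b) ^ 2 +
  oddWeight x * (-1) ^ b * ((b : ℤ) ^ 2 + 2 * a * b) ^ 2 +
  oddWeight (x + y) * (-1) ^ (a + b) * ((a : ℤ) ^ 2 - b ^ 2) ^ 2

/-- The function summed over the quadruples with `a ≠ b`. -/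
def liouvilleTarget (a b x y : ℕ) : ℤ :=
  oddWeight y * (-1) ^ a * ((a : ℤ) ^ 2 - 2 * a * b) ^ 2 +
  oddWeight x * (-1) ^ b * ((b : ℤ) ^ 2 - 2 * a * b) ^ 2 +
  oddWeight (x + y) * (-1) ^ (a + b) * ((a : ℤ) ^ 2 - b ^ 2) ^ 2

/-- The substitution permutes the three summands: the first stays in place and the other two are
exchanged. Signs and weights agree because they depend only on parities. -/
theorem liouvilleSource_add (a b x y : ℕ) :
    liouvilleSource a b (x + y) y = liouvilleTarget a (a + b) x y := by
  have h (z : ℕ) : ((-1 : ℤ) ^ z) ^ 2 = 1 := by rw [← pow_mul, mul_comm, pow_mul]; simp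
  have ha := h a
  have hy := h y
  simp only [liouvilleSource, liouvilleTarget, oddWeight, pow_add]
  push_cast
  generalize (-1 : ℤ) ^ a = u at *
  generalize (-1 : ℤ) ^ b = v at *
  generalize (-1 : ℤ) ^ x = w at *
  generalize (-1 : ℤ) ^ y = t at *
  linear_combination (-(u * v * w * ((a : ℤ) ^ 2 - b ^ 2) ^ 2)) * hy -
    (1 - w * t) * v * ((a + b : ℤ) ^ 2 - a ^ 2) ^ 2 * ha

theorem liouvilleSource_swap (a b x y : ℕ) :
    liouvilleSource a b x y = liouvilleSource b a y x := by
  simp only [liouvilleSource, add_comm x y, add_comm a b]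
  ring

theorem liouvilleTarget_swap (a b x y : ℕ) :
    liouvilleTarget a b x y = liouvilleTarget b a y x := by
  simp only [liouvilleTarget, add_comm x y, add_comm a b]
  ring

/-- One Euclidean step preserves the form: `a x + b y = a (x - y) + (a + b) y` when `y < x`, and
symmetrically otherwise. It is a bijection from quadruples with `x ≠ y` to those with `a ≠ b`, so
only the diagonals `x = y` and `a = b` contribute to the difference of the full sums. -/
theorem sum_liouvilleSource_eq_sum_liouvilleTarget (n : ℕ) :
    ∑ r ∈ quadruples n with r.1.2 ≠ r.2.2, liouvilleSource r.1.1 r.2.1 r.1.2 r.2.2 =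
    ∑ r ∈ quadruples n with r.1.1 ≠ r.2.1, liouvilleTarget r.1.1 r.2.1 r.1.2 r.2.2 := by
  refine Finset.sum_nbij'
    (fun r => if r.2.2 < r.1.2 then ((r.1.1, r.1.2 - r.2.2), (r.1.1 + r.2.1, r.2.2))
      else ((r.1.1 + r.2.1, r.1.2), (r.2.1, r.2.2 - r.1.2)))
    (fun r => if r.1.1 < r.2.1 then ((r.1.1, r.1.2 + r.2.2), (r.2.1 - r.1.1, r.2.2))
      else ((r.1.1 - r.2.1, r.1.2), (r.2.1, r.1.2 + r.2.2))) ?_ ?_ ?_ ?_ ?_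
  · rintro ⟨⟨a, x⟩, b, y⟩ h
    obtain ⟨h, hne⟩ := Finset.mem_filter.1 h
    obtain ⟨ha, hx, hb, hy, h⟩ := mem_quadruples.1 h
    dsimp only at hne ⊢
    split_ifs with hlt
    · obtain ⟨z, rfl⟩ := Nat.exists_eq_add_of_lt hlt
      refine Finset.mem_filter.2 ⟨mem_quadruples.2 ⟨ha, by omega, by omega, hy, ?_⟩, ?_⟩
      · rw [show y + z + 1 - y = z + 1 by omega, ← h]; ring
      · dsimp only; omega
    · obtain ⟨z, rfl⟩ := Nat.exists_eq_add_of_lt (show x < y by omega)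
      refine Finset.mem_filter.2 ⟨mem_quadruples.2 ⟨by omega, hx, hb, by omega, ?_⟩, ?_⟩
      · rw [show x + z + 1 - x = z + 1 by omega, ← h]; ring
      · dsimp only; omega
  · rintro ⟨⟨a, x⟩, b, y⟩ h
    obtain ⟨h, hne⟩ := Finset.mem_filter.1 h
    obtain ⟨ha, hx, hb, hy, h⟩ := mem_quadruples.1 h
    dsimp only at hne ⊢
    split_ifs with hlt
    · obtain ⟨z, rfl⟩ := Nat.exists_eq_add_of_lt hlt
      refine Finset.mem_filter.2 ⟨mem_quadruples.2 ⟨ha, by omega, by omega, hy, ?_⟩, ?_⟩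
      · rw [show a + z + 1 - a = z + 1 by omega, ← h]; ring
      · dsimp only; omega
    · obtain ⟨z, rfl⟩ := Nat.exists_eq_add_of_lt (show b < a by omega)
      refine Finset.mem_filter.2 ⟨mem_quadruples.2 ⟨by omega, hx, hb, by omega, ?_⟩, ?_⟩
      · rw [show b + z + 1 - b = z + 1 by omega, ← h]; ring
      · dsimp only; omega
  · rintro ⟨⟨a, x⟩, b, y⟩ h
    obtain ⟨h, hne⟩ := Finset.mem_filter.1 h
    obtain ⟨ha, hx, hb, hy, h⟩ := mem_quadruples.1 h
    dsimp only at hne ⊢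
    by_cases hlt : y < x
    · simp [hlt, hlt.le, hb]
    · have hlt' : x < y := by omega
      simp [hlt, hlt'.le]
  · rintro ⟨⟨a, x⟩, b, y⟩ h
    obtain ⟨h, hne⟩ := Finset.mem_filter.1 h
    obtain ⟨ha, hx, hb, hy, h⟩ := mem_quadruples.1 h
    dsimp only at hne ⊢
    by_cases hlt : a < b
    · simp [hlt, hlt.le, hx]
    · have hlt' : b < a := by omega
      simp [hlt, hlt'.le]
  · rintro ⟨⟨a, x⟩, b, y⟩ h
    obtain ⟨h, hne⟩ := Finset.mem_filter.1 h
    dsimp only at hne ⊢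
    split_ifs with hlt
    · obtain ⟨z, rfl⟩ := Nat.exists_eq_add_of_lt hlt
      rw [show y + z + 1 - y = z + 1 by omega, show y + z + 1 = z + 1 + y by omega]
      exact liouvilleSource_add a b (z + 1) y
    · obtain ⟨z, rfl⟩ := Nat.exists_eq_add_of_lt (show x < y by omega)
      dsimp only
      rw [show x + z + 1 - x = z + 1 by omega, show x + z + 1 = z + 1 + x by omega,
        liouvilleSource_swap, liouvilleTarget_swap, add_comm a b]
      exact liouvilleSource_add b a (z + 1) x

theorem sum_quadruples_codivisor_eq (n : ℕ) (f : ℕ → ℕ → ℕ → ℕ → ℤ) :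
    ∑ r ∈ quadruples n with r.1.2 = r.2.2, f r.1.1 r.2.1 r.1.2 r.2.2 =
    ∑ p ∈ n.divisorsAntidiagonal, ∑ a ∈ Finset.Ico 1 p.1, f a (p.1 - a) p.2 p.2 := by
  rw [Finset.sum_sigma']
  refine Finset.sum_nbij' (fun r => ⟨(r.1.1 + r.2.1, r.1.2), r.1.1⟩)
    (fun z => ((z.2, z.1.2), (z.1.1 - z.2, z.1.2))) ?_ ?_ ?_ ?_ ?_
  · rintro ⟨⟨a, x⟩, b, y⟩ h
    obtain ⟨h, rfl : x = y⟩ := Finset.mem_filter.1 h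
    obtain ⟨ha, hx, hb, hy, rfl⟩ := mem_quadruples.1 h
    simp only [Finset.mem_sigma, Nat.mem_divisorsAntidiagonal, Finset.mem_Ico]
    exact ⟨⟨by ring, by positivity⟩, by omega⟩
  · rintro ⟨⟨d, e⟩, a⟩ h
    simp only [Finset.mem_sigma, Nat.mem_divisorsAntidiagonal, Finset.mem_Ico] at h
    obtain ⟨⟨rfl, h0⟩, h1, h2⟩ := h
    have he : 0 < e := Nat.pos_of_ne_zero fun h => h0 (by simp [h])
    refine Finset.mem_filter.2 ⟨mem_quadruples.2 ⟨h1, he, Nat.sub_pos_of_lt h2, he, ?_⟩, rfl⟩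
    rw [← add_mul]
    exact congrArg (· * e) (Nat.add_sub_cancel' h2.le)
  · rintro ⟨⟨a, x⟩, b, y⟩ h
    obtain ⟨h, rfl : x = y⟩ := Finset.mem_filter.1 h
    simp
  · rintro ⟨⟨d, e⟩, a⟩ h
    simp only [Finset.mem_sigma, Nat.mem_divisorsAntidiagonal, Finset.mem_Ico] at h
    simp [h.2.2.le]
  · rintro ⟨⟨a, x⟩, b, y⟩ h
    obtain ⟨h, rfl : x = y⟩ := Finset.mem_filter.1 h
    simp

theorem sum_quadruples_divisor_eq (n : ℕ) (f : ℕ → ℕ → ℕ → ℕ → ℤ) :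
    ∑ r ∈ quadruples n with r.1.1 = r.2.1, f r.1.1 r.2.1 r.1.2 r.2.2 =
    ∑ p ∈ n.divisorsAntidiagonal, ∑ x ∈ Finset.Ico 1 p.2, f p.1 p.1 x (p.2 - x) := by
  rw [Finset.sum_sigma']
  refine Finset.sum_nbij' (fun r => ⟨(r.1.1, r.1.2 + r.2.2), r.1.2⟩)
    (fun z => ((z.1.1, z.2), (z.1.1, z.1.2 - z.2))) ?_ ?_ ?_ ?_ ?_
  · rintro ⟨⟨a, x⟩, b, y⟩ h
    obtain ⟨h, rfl : a = b⟩ := Finset.mem_filter.1 h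
    obtain ⟨ha, hx, hb, hy, rfl⟩ := mem_quadruples.1 h
    simp only [Finset.mem_sigma, Nat.mem_divisorsAntidiagonal, Finset.mem_Ico]
    exact ⟨⟨by ring, by positivity⟩, by omega⟩
  · rintro ⟨⟨d, e⟩, x⟩ h
    simp only [Finset.mem_sigma, Nat.mem_divisorsAntidiagonal, Finset.mem_Ico] at h
    obtain ⟨⟨rfl, h0⟩, h1, h2⟩ := h
    have hd : 0 < d := Nat.pos_of_ne_zero fun h => h0 (by simp [h])
    refine Finset.mem_filter.2 ⟨mem_quadruples.2 ⟨hd, h1, hd, Nat.sub_pos_of_lt h2, ?_⟩, rfl⟩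
    rw [← mul_add]
    exact congrArg (d * ·) (Nat.add_sub_cancel' h2.le)
  · rintro ⟨⟨a, x⟩, b, y⟩ h
    obtain ⟨h, rfl : a = b⟩ := Finset.mem_filter.1 h
    simp
  · rintro ⟨⟨d, e⟩, x⟩ h
    simp only [Finset.mem_sigma, Nat.mem_divisorsAntidiagonal, Finset.mem_Ico] at h
    simp [h.2.2.le]
  · rintro ⟨⟨a, x⟩, b, y⟩ h
    obtain ⟨h, rfl : a = b⟩ := Finset.mem_filter.1 h
    simp

theorem neg_one_pow_sub_of_le {d a : ℕ} (h : a ≤ d) :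
    (-1 : ℤ) ^ (d - a) = (-1) ^ d * (-1) ^ a := by
  obtain ⟨c, rfl⟩ := Nat.exists_eq_add_of_le h
  have : ((-1 : ℤ) ^ a) ^ 2 = 1 := by rw [← pow_mul, mul_comm, pow_mul]; simp
  rw [Nat.add_sub_cancel_left, pow_add]
  linear_combination (-(-1 : ℤ) ^ c) * this

/-- The limit `j` and the parameters `m`, `e` are independent so that induction on `j` applies; the
case needed is `j = m = d`, `e = (-1)^d`. -/
theorem two_mul_sum_alternating (m e : ℤ) {j : ℕ} (hj : 1 ≤ j) :
    2 * ∑ a ∈ Finset.Ico 1 j, (-1 : ℤ) ^ a *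
      ((2 * a * m - a ^ 2) ^ 2 + e * (m ^ 2 - a ^ 2) ^ 2) =
    -m - (-1) ^ j * (4 * m ^ 2 * (j ^ 2 - j) - m * (4 * j ^ 3 - 6 * j ^ 2 + 1)
      + j ^ 4 - 2 * j ^ 3 + j)
    + e * (-m ^ 4 - (-1) ^ j * (m ^ 4 - 2 * m ^ 2 * (j ^ 2 - j) + j ^ 4 - 2 * j ^ 3 + j)) := by
  induction j, hj using Nat.le_induction with
  | base => simp; ring
  | succ j hj ih =>
    rw [Finset.sum_Ico_succ_top hj, mul_add, ih]
    push_cast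
    ring

theorem sum_liouvilleSource_diagonal {d : ℕ} (hd : 0 < d) (e : ℕ) :
    ∑ a ∈ Finset.Ico 1 d, liouvilleSource a (d - a) e e =
      oddWeight e * (-d - (-1) ^ d * (d : ℤ) ^ 4) := by
  have hsq : ((-1 : ℤ) ^ d) ^ 2 = 1 := by rw [← pow_mul, mul_comm, pow_mul]; simp
  have h := two_mul_sum_alternating d ((-1) ^ d) hd
  have h2 : ∑ a ∈ Finset.Ico 1 d, liouvilleSource a (d - a) e e = oddWeight e *
      ∑ a ∈ Finset.Ico 1 d, (-1 : ℤ) ^ a *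
      ((2 * a * d - a ^ 2) ^ 2 + (-1) ^ d * ((d : ℤ) ^ 2 - a ^ 2) ^ 2) := by
    rw [Finset.mul_sum]
    refine Finset.sum_congr rfl fun a ha => ?_
    have hle := (Finset.mem_Ico.1 ha).2.le
    -- The third summand vanishes on the diagonal; with `b = d - a` the other two become `2ad - a^2`
    -- and `d^2 - a^2` squared.
    have : oddWeight (e + e) = 0 := by simp [oddWeight, ← two_mul]
    rw [liouvilleSource, this, neg_one_pow_sub_of_le hle]
    push_cast [hle]
    ring
  rw [h2]
  refine mul_left_cancel₀ (two_ne_zero (α := ℤ)) ?_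
  rw [mul_left_comm, h]
  linear_combination oddWeight e * (-d) * hsq

theorem two_mul_sum_oddWeight (c : ℤ) {j : ℕ} (hj : 1 ≤ j) :
    2 * ∑ x ∈ Finset.Ico 1 j, (2 - (-1 : ℤ) ^ x - c * (-1) ^ x) =
      4 * (j - 1) + (1 + c) * (1 + (-1) ^ j) := by
  induction j, hj using Nat.le_induction with
  | base => simp
  | succ j hj ih =>
    rw [Finset.sum_Ico_succ_top hj, mul_add, ih]
    push_cast
    ring

theorem sum_liouvilleTarget_diagonal (d : ℕ) {e : ℕ} (he : 0 < e) :
    ∑ x ∈ Finset.Ico 1 e, liouvilleTarget d d x (e - x) =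
      (-1) ^ d * (d : ℤ) ^ 4 * (2 * e - oddWeight e) := by
  have hsq : ((-1 : ℤ) ^ e) ^ 2 = 1 := by rw [← pow_mul, mul_comm, pow_mul]; simp
  have h := two_mul_sum_oddWeight ((-1) ^ e) he
  have h2 : ∑ x ∈ Finset.Ico 1 e, liouvilleTarget d d x (e - x) = (-1) ^ d * (d : ℤ) ^ 4 *
      ∑ x ∈ Finset.Ico 1 e, (2 - (-1 : ℤ) ^ x - (-1) ^ e * (-1) ^ x) := by
    rw [Finset.mul_sum]
    refine Finset.sum_congr rfl fun x hx => ?_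
    rw [liouvilleTarget, oddWeight, oddWeight,
      neg_one_pow_sub_of_le (Finset.mem_Ico.1 hx).2.le]
    ring
  rw [h2]
  refine mul_left_cancel₀ (two_ne_zero (α := ℤ)) ?_
  rw [mul_left_comm, h, oddWeight]
  linear_combination (-1) ^ d * (d : ℤ) ^ 4 * hsq

theorem sum_quadruples_swap (n : ℕ) (f : ℕ → ℕ → ℕ → ℕ → ℤ) :
    ∑ r ∈ quadruples n, f r.1.1 r.2.1 r.1.2 r.2.2 =
    ∑ r ∈ quadruples n, f r.2.1 r.1.1 r.2.2 r.1.2 := by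
  refine Finset.sum_nbij' Prod.swap Prod.swap ?_ ?_ (fun _ _ => rfl) (fun _ _ => rfl)
    (fun _ _ => rfl)
  all_goals
    rintro ⟨⟨a, x⟩, b, y⟩ h
    obtain ⟨ha, hx, hb, hy, h⟩ := mem_quadruples.1 h
    exact mem_quadruples.2 ⟨hb, hy, ha, hx, by rw [add_comm]; exact h⟩

/-- The convolution identity behind the theorem on sums of eight squares. -/
theorem sum_oddCodivisorSum_mul_altCubeSum (n : ℕ) :
    16 * ∑ i ∈ Finset.HasAntidiagonal.antidiagonal n, oddCodivisorSum i.1 * altCubeSum i.2 =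
      -oddCodivisorSum n - 2 * n * altCubeSum n := by
  have h1 : ∑ i ∈ Finset.HasAntidiagonal.antidiagonal n, oddCodivisorSum i.1 * altCubeSum i.2 =
      ∑ r ∈ quadruples n, oddWeight r.1.2 * r.1.1 * ((-1) ^ r.2.1 * (r.2.1 : ℤ) ^ 3) := by
    rw [← sum_antidiagonal_divisorsAntidiagonal n
      (fun p q => oddWeight p.2 * p.1 * ((-1) ^ q.1 * (q.1 : ℤ) ^ 3))]
    simp only [oddCodivisorSum, altCubeSum, Finset.sum_mul_sum]
  have h2 := sum_quadruples_swap n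
    (fun a b x _ => oddWeight x * a * ((-1) ^ b * (b : ℤ) ^ 3))
  -- The third summands cancel, and `(a^2 + 2ab)^2 - (a^2 - 2ab)^2 = 8 a^3 b`; the two resulting
  -- sums agree by symmetry, whence the constant 16.
  have h3 : ∑ r ∈ quadruples n, (liouvilleSource r.1.1 r.2.1 r.1.2 r.2.2 -
      liouvilleTarget r.1.1 r.2.1 r.1.2 r.2.2) =
      8 * ∑ r ∈ quadruples n, oddWeight r.1.2 * r.1.1 * ((-1) ^ r.2.1 * (r.2.1 : ℤ) ^ 3) +
      8 * ∑ r ∈ quadruples n, oddWeight r.2.2 * r.2.1 * ((-1) ^ r.1.1 * (r.1.1 : ℤ) ^ 3) := by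
    rw [Finset.mul_sum, Finset.mul_sum, ← Finset.sum_add_distrib]
    refine Finset.sum_congr rfl fun r _ => ?_
    simp only [liouvilleSource, liouvilleTarget]
    ring
  rw [Finset.sum_sub_distrib,
    ← Finset.sum_filter_add_sum_filter_not (quadruples n) (fun r => r.1.2 = r.2.2)
      (fun r => liouvilleSource r.1.1 r.2.1 r.1.2 r.2.2),
    ← Finset.sum_filter_add_sum_filter_not (quadruples n) (fun r => r.1.1 = r.2.1)
      (fun r => liouvilleTarget r.1.1 r.2.1 r.1.2 r.2.2),
    sum_quadruples_codivisor_eq n liouvilleSource, sum_quadruples_divisor_eq n liouvilleTarget]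
    at h3
  have h4 := sum_liouvilleSource_eq_sum_liouvilleTarget n
  have h5 : ∑ p ∈ n.divisorsAntidiagonal, ∑ a ∈ Finset.Ico 1 p.1,
      liouvilleSource a (p.1 - a) p.2 p.2 - ∑ p ∈ n.divisorsAntidiagonal,
      ∑ x ∈ Finset.Ico 1 p.2, liouvilleTarget p.1 p.1 x (p.2 - x) =
      -oddCodivisorSum n - 2 * n * altCubeSum n := by
    rw [oddCodivisorSum, altCubeSum, Finset.mul_sum, ← Finset.sum_neg_distrib,
      ← Finset.sum_sub_distrib, ← Finset.sum_sub_distrib]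
    refine Finset.sum_congr rfl fun p hp => ?_
    obtain ⟨rfl, hne⟩ := Nat.mem_divisorsAntidiagonal.1 hp
    simp only [ne_eq, mul_eq_zero, not_or, ← Nat.pos_iff_ne_zero] at hne
    rw [sum_liouvilleSource_diagonal hne.1, sum_liouvilleTarget_diagonal _ hne.2]
    push_cast
    ring
  rw [h1]
  linear_combination -h3 + h4 + h5 + 8 * h2

/-! ### The infinite product for overpartitions -/

open PowerSeries in
/-- The factor `(1 + X ^ (i + 1)) / (1 - X ^ (i + 1))` of the generating function of the overpartitions. -/
noncomputable def overpartitionFactor (i : ℕ) : PowerSeries ℤ :=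
  (1 + X ^ (i + 1)) * invOfUnit (1 - X ^ (i + 1)) 1

/-- The generating function of the overpartitions. -/
noncomputable def overpartitionSeries : PowerSeries ℤ :=
  PowerSeries.mk fun n => (Nat.card (Overpartition n) : ℤ)

/-- The product of the first `n` factors of the generating function of the overpartitions. -/
noncomputable def overpartitionProd (n : ℕ) : PowerSeries ℤ :=
  ∏ i ∈ Finset.range n, overpartitionFactor i

theorem overpartitionFactor_mul (i : ℕ) :
    overpartitionFactor i * (1 - PowerSeries.X ^ (i + 1)) = 1 + PowerSeries.X ^ (i + 1) := by
  rw [overpartitionFactor, mul_assoc, mul_comm (PowerSeries.invOfUnit _ _),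
    PowerSeries.mul_invOfUnit _ _ (by simp), mul_one]

theorem one_sub_X_pow_ne_zero (i : ℕ) : (1 - PowerSeries.X ^ (i + 1) : PowerSeries ℤ) ≠ 0 := by
  intro h
  simpa using congrArg PowerSeries.constantCoeff h

/-- An overpartition is a partition together with a subset of its set of part sizes. -/
def overpartitionEquiv (n : ℕ) :
    Overpartition n ≃ Σ p : n.Partition, {S // S ∈ p.parts.toFinset.powerset} where
  toFun π := ⟨π.toPartition, π.overlined, Finset.mem_powerset.2 π.overlined_subset⟩
  invFun z := ⟨z.1, z.2.1, Finset.mem_powerset.1 z.2.2⟩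
  left_inv _ := rfl
  right_inv _ := rfl

/-- Each distinct part size is either overlined or not, which gives a factor 2 per part size. -/
theorem overpartitionSeries_eq_genFun :
    overpartitionSeries = Nat.Partition.genFun fun _ _ => (2 : ℤ) := by
  ext n
  rw [overpartitionSeries, PowerSeries.coeff_mk, Nat.Partition.coeff_genFun,
    Nat.card_congr (overpartitionEquiv n), Nat.card_sigma]
  push_cast
  refine Finset.sum_congr rfl fun p _ => ?_
  rw [Nat.card_eq_fintype_card, Fintype.card_coe, Finset.card_powerset]
  simp [Finsupp.prod]

open scoped PowerSeries.WithPiTopology in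
theorem overpartitionFactor_eq_tsum (i : ℕ) :
    overpartitionFactor i =
      1 + ∑' j : ℕ, (2 : ℤ) • (PowerSeries.X : PowerSeries ℤ) ^ ((i + 1) * (j + 1)) := by
  have h0 : PowerSeries.constantCoeff ((PowerSeries.X : PowerSeries ℤ) ^ (i + 1)) = 0 := by simp
  have hs := PowerSeries.WithPiTopology.summable_pow_of_constantCoeff_eq_zero h0
  have h := PowerSeries.WithPiTopology.one_sub_mul_tsum_pow_of_constantCoeff_eq_zero h0
  have h2 : ∑' j : ℕ, (2 : ℤ) • (PowerSeries.X : PowerSeries ℤ) ^ ((i + 1) * (j + 1)) =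
      2 * PowerSeries.X ^ (i + 1) * ∑' j : ℕ, (PowerSeries.X ^ (i + 1)) ^ j := by
    rw [← hs.tsum_mul_left]
    refine tsum_congr fun j => ?_
    rw [mul_add, mul_one, pow_add, pow_mul, zsmul_eq_mul]
    push_cast
    ring
  refine mul_right_cancel₀ (one_sub_X_pow_ne_zero i) ?_
  rw [overpartitionFactor_mul, h2]
  linear_combination (-2 * PowerSeries.X ^ (i + 1)) * h

open scoped PowerSeries.WithPiTopology in
theorem tendsto_overpartitionProd :
    Filter.Tendsto overpartitionProd Filter.atTop (nhds overpartitionSeries) := by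
  have h := (Nat.Partition.hasProd_genFun fun _ _ => (2 : ℤ)).tendsto_prod_nat
  rw [overpartitionSeries_eq_genFun]
  exact h.congr fun n =>
    Finset.prod_congr rfl fun i _ => (overpartitionFactor_eq_tsum i).symm

/-! ### Logarithmic differentiation and the eighth power -/

/-- The Euler operator `X * d/dX` on power series. -/
noncomputable def eulerDerivative (f : PowerSeries ℤ) : PowerSeries ℤ :=
  PowerSeries.X * PowerSeries.derivative ℤ f

theorem coeff_eulerDerivative (f : PowerSeries ℤ) (n : ℕ) :
    PowerSeries.coeff n (eulerDerivative f) = n * PowerSeries.coeff n f := by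
  cases n with
  | zero => simp [eulerDerivative]
  | succ n =>
    rw [eulerDerivative, mul_comm, PowerSeries.coeff_succ_mul_X, PowerSeries.coeff_derivative,
      mul_comm]
    push_cast
    rfl

theorem eulerDerivative_mul (f g : PowerSeries ℤ) :
    eulerDerivative (f * g) = eulerDerivative f * g + f * eulerDerivative g := by
  simp only [eulerDerivative, Derivation.leibniz, smul_eq_mul]
  ring

theorem eulerDerivative_pow (f : PowerSeries ℤ) (n : ℕ) :
    eulerDerivative (f ^ (n + 1)) = (n + 1) * f ^ n * eulerDerivative f := by
  simp only [eulerDerivative, PowerSeries.derivative_pow, Nat.add_sub_cancel]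
  push_cast
  ring

theorem eulerDerivative_X_pow (n : ℕ) :
    eulerDerivative (PowerSeries.X ^ n) = n * (PowerSeries.X : PowerSeries ℤ) ^ n := by
  ext m
  rw [coeff_eulerDerivative, ← nsmul_eq_mul n (PowerSeries.X ^ n : PowerSeries ℤ), map_nsmul,
    PowerSeries.coeff_X_pow]
  split_ifs with h <;> simp [h]

/-- The logarithmic derivative of the `i`-th factor of the generating function. -/
noncomputable def lambertTerm (i : ℕ) : PowerSeries ℤ :=
  (i + 1) * PowerSeries.expand (i + 1) i.succ_ne_zero (PowerSeries.mk oddWeight)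

theorem mk_oddWeight_mul : PowerSeries.mk oddWeight * (1 - PowerSeries.X ^ 2) =
    2 * PowerSeries.X := by
  ext n
  rw [mul_sub, mul_one, map_sub, two_mul, map_add]
  match n with
  | 0 => simp [oddWeight]
  | 1 => simp [oddWeight, PowerSeries.coeff_X, PowerSeries.coeff_mul_X_pow']
  | n + 2 =>
    rw [PowerSeries.coeff_mul_X_pow]
    simp [oddWeight, PowerSeries.coeff_X, pow_add]

theorem lambertTerm_mul (i : ℕ) : lambertTerm i *
    ((1 - PowerSeries.X ^ (i + 1)) * (1 + PowerSeries.X ^ (i + 1))) =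
    2 * ((i : PowerSeries ℤ) + 1) * (PowerSeries.X : PowerSeries ℤ) ^ (i + 1) := by
  have h := congrArg (PowerSeries.expand (i + 1) i.succ_ne_zero) mk_oddWeight_mul
  simp only [map_mul, map_sub, map_one, map_pow, PowerSeries.expand_X, map_ofNat] at h
  rw [lambertTerm]
  linear_combination (i + 1 : PowerSeries ℤ) * h

/-- With `k = i + 1`, the logarithmic derivative of `(1 + q^k) / (1 - q^k)` is `2 k q^k / (1 -
q^(2k))`; denominators are cleared before comparing. -/
theorem eulerDerivative_overpartitionFactor (i : ℕ) :
    eulerDerivative (overpartitionFactor i) = overpartitionFactor i * lambertTerm i := by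
  have h1 := overpartitionFactor_mul i
  have h2 := congrArg eulerDerivative h1
  have h3 := lambertTerm_mul i
  have h4 := eulerDerivative_X_pow (i + 1)
  have h5 : eulerDerivative (1 - PowerSeries.X ^ (i + 1)) =
      -((i + 1) * (PowerSeries.X : PowerSeries ℤ) ^ (i + 1)) := by
    rw [eulerDerivative, map_sub, mul_sub, ← eulerDerivative, ← eulerDerivative, h4]
    simp [eulerDerivative]
  have h6 : eulerDerivative (1 + PowerSeries.X ^ (i + 1)) =
      (i + 1) * (PowerSeries.X : PowerSeries ℤ) ^ (i + 1) := by
    rw [eulerDerivative, map_add, mul_add, ← eulerDerivative, ← eulerDerivative, h4]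
    simp [eulerDerivative]
  rw [eulerDerivative_mul, h5, h6] at h2
  have hne : (1 + PowerSeries.X ^ (i + 1) : PowerSeries ℤ) ≠ 0 := by
    intro h
    simpa using congrArg PowerSeries.constantCoeff h
  refine mul_right_cancel₀ (mul_ne_zero (one_sub_X_pow_ne_zero i) hne) ?_
  linear_combination (1 + PowerSeries.X ^ (i + 1)) * h2 - overpartitionFactor i * h3
    - ((i : PowerSeries ℤ) + 1) * PowerSeries.X ^ (i + 1) * h1

theorem eulerDerivative_overpartitionProd (n : ℕ) :
    eulerDerivative (overpartitionProd n) =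
      overpartitionProd n * ∑ i ∈ Finset.range n, lambertTerm i := by
  induction n with
  | zero => simp [overpartitionProd, eulerDerivative]
  | succ n ih =>
    rw [overpartitionProd, Finset.prod_range_succ, ← overpartitionProd, eulerDerivative_mul, ih,
      eulerDerivative_overpartitionFactor, Finset.sum_range_succ]
    ring

/-- The generating function of `oddCodivisorSum`. -/
noncomputable def oddCodivisorSeries : PowerSeries ℤ := PowerSeries.mk oddCodivisorSum

/-- The generating function of `altCubeSum`. -/
noncomputable def altCubeSeries : PowerSeries ℤ := PowerSeries.mk altCubeSum

theorem coeff_sum_lambertTerm {m n : ℕ} (h : m ≤ n) :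
    PowerSeries.coeff m (∑ i ∈ Finset.range n, lambertTerm i) = oddCodivisorSum m := by
  rw [map_sum]
  have h1 (i : ℕ) : PowerSeries.coeff m (lambertTerm i) =
      if i + 1 ∣ m then oddWeight (m / (i + 1)) * (i + 1 : ℕ) else 0 := by
    rw [lambertTerm, show ((i : PowerSeries ℤ) + 1) = ((i + 1 : ℕ) : PowerSeries ℤ) by simp,
      ← nsmul_eq_mul, map_nsmul, PowerSeries.coeff_expand]
    split_ifs <;> simp [mul_comm]
  simp_rw [h1]
  rcases Nat.eq_zero_or_pos m with rfl | hm
  · simp [oddCodivisorSum, oddWeight]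
  rw [oddCodivisorSum, Nat.sum_divisorsAntidiagonal fun a b => oddWeight b * a,
    ← Finset.sum_filter, Finset.sum_filter]
  rw [Finset.range_eq_Ico, Finset.sum_Ico_add' (fun i => if i ∣ m then
    oddWeight (m / i) * (i : ℤ) else 0) 0 n 1, ← Finset.sum_filter]
  refine Finset.sum_congr ?_ fun _ _ => rfl
  ext d
  simp only [Finset.mem_filter, Finset.mem_Ico, Nat.mem_divisors]
  constructor
  · rintro ⟨_, h⟩
    exact ⟨h, hm.ne'⟩
  · rintro ⟨hd, _⟩
    have := Nat.le_of_dvd hm hd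
    have := Nat.pos_of_dvd_of_pos hd hm
    exact ⟨by omega, hd⟩

open scoped PowerSeries.WithPiTopology in
theorem eulerDerivative_overpartitionSeries :
    eulerDerivative overpartitionSeries = overpartitionSeries * oddCodivisorSeries := by
  have h1 : Filter.Tendsto (fun n => ∑ i ∈ Finset.range n, lambertTerm i) Filter.atTop
      (nhds oddCodivisorSeries) := by
    rw [PowerSeries.WithPiTopology.tendsto_iff_coeff_tendsto]
    intro m
    refine tendsto_atTop_of_eventually_const (i₀ := m) fun n hn => ?_
    rw [coeff_sum_lambertTerm hn, oddCodivisorSeries, PowerSeries.coeff_mk]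
  have h2 := tendsto_overpartitionProd.mul h1
  simp_rw [← eulerDerivative_overpartitionProd] at h2
  refine tendsto_nhds_unique ?_ h2
  have h3 := tendsto_overpartitionProd
  rw [PowerSeries.WithPiTopology.tendsto_iff_coeff_tendsto] at h3 ⊢
  intro m
  simp_rw [coeff_eulerDerivative]
  exact (h3 m).const_mul _

theorem eulerDerivative_altCubeSeries :
    2 * eulerDerivative altCubeSeries =
      -oddCodivisorSeries - 16 * (oddCodivisorSeries * altCubeSeries) := by
  ext n
  have h := sum_oddCodivisorSum_mul_altCubeSum n
  rw [show (2 : PowerSeries ℤ) = PowerSeries.C 2 by simp,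
    show (16 : PowerSeries ℤ) = PowerSeries.C 16 by simp, PowerSeries.coeff_C_mul,
    coeff_eulerDerivative, map_sub, map_neg, PowerSeries.coeff_C_mul, PowerSeries.coeff_mul]
  simp only [oddCodivisorSeries, altCubeSeries, PowerSeries.coeff_mk]
  linear_combination h

theorem constantCoeff_overpartitionSeries :
    PowerSeries.constantCoeff overpartitionSeries = 1 := by
  rw [overpartitionSeries_eq_genFun, ← PowerSeries.coeff_zero_eq_constantCoeff_apply,
    Nat.Partition.coeff_genFun]
  simp

/-- The convolution identity says exactly that the Euler derivative of the left side is zero, so the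
product equals its constant term. -/
theorem altCubeSeries_mul_overpartitionSeries_pow :
    (1 + 16 * altCubeSeries) * overpartitionSeries ^ 8 = 1 := by
  refine PowerSeries.derivative.ext ?_ ?_
  · refine mul_left_cancel₀ PowerSeries.X_ne_zero ?_
    change eulerDerivative _ = eulerDerivative _
    have h16 : eulerDerivative (1 + 16 * altCubeSeries) = 16 * eulerDerivative altCubeSeries := by
      ext n
      rw [show (16 : PowerSeries ℤ) = PowerSeries.C 16 by simp, PowerSeries.coeff_C_mul,
        coeff_eulerDerivative, coeff_eulerDerivative, map_add, PowerSeries.coeff_C_mul,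
        PowerSeries.coeff_one]
      split_ifs with h
      · simp [h]
      · ring
    have h1 : eulerDerivative 1 = 0 := by simp [eulerDerivative]
    rw [eulerDerivative_mul, eulerDerivative_pow, h16, eulerDerivative_overpartitionSeries, h1]
    push_cast
    linear_combination (8 * overpartitionSeries ^ 8) * eulerDerivative_altCubeSeries
  · have h0 : PowerSeries.constantCoeff altCubeSeries = 0 := by
      rw [← PowerSeries.coeff_zero_eq_constantCoeff_apply, altCubeSeries, PowerSeries.coeff_mk]
      simp [altCubeSum]
    simp [constantCoeff_overpartitionSeries, h0]

/-! ### Gauss's theta identity -/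

/-- The partial sums of the theta series `∑ (-1) ^ j * X ^ (j ^ 2)`. -/
noncomputable def thetaSum (n : ℕ) : PowerSeries ℤ :=
  1 + ∑ j ∈ Finset.range n, 2 * (-1) ^ (j + 1) * PowerSeries.X ^ ((j + 1) ^ 2)

/-- The coefficients in the finite form of Gauss's theta identity. -/
noncomputable def gaussWeight : ℕ → PowerSeries ℤ
  | 0 => 1
  | s + 1 => overpartitionProd s * (1 + overpartitionFactor s)

theorem overpartitionProd_succ (n : ℕ) :
    overpartitionProd (n + 1) = overpartitionProd n * overpartitionFactor n :=
  Finset.prod_range_succ _ _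

/-- In q-Pochhammer notation the weight is `(-1; q)_n / (q; q)_n`, while the partial product is
`(-q; q)_n / (q; q)_n`. -/
theorem one_add_X_pow_mul_gaussWeight (n : ℕ) :
    (1 + PowerSeries.X ^ n) * gaussWeight n = 2 * overpartitionProd n := by
  cases n with
  | zero => simp [gaussWeight, overpartitionProd]; norm_num
  | succ s =>
    refine mul_right_cancel₀ (one_sub_X_pow_ne_zero s) ?_
    rw [gaussWeight, overpartitionProd_succ]
    have h := overpartitionFactor_mul s
    linear_combination
      overpartitionProd s * (PowerSeries.X ^ (s + 1) - 1) * h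

theorem gaussWeight_succ_mul (s : ℕ) :
    gaussWeight (s + 1) * (1 - PowerSeries.X ^ (s + 1)) =
      gaussWeight s * (1 + PowerSeries.X ^ s) := by
  rw [mul_comm (gaussWeight s), one_add_X_pow_mul_gaussWeight, gaussWeight]
  linear_combination overpartitionProd s * overpartitionFactor_mul s

/-- The right-hand side of the finite form of Gauss's theta identity. -/
noncomputable def gaussThetaSum (n : ℕ) : PowerSeries ℤ :=
  ∑ s ∈ Finset.range (n + 1), (-1) ^ s * gaussWeight s * PowerSeries.X ^ (s * (n + 1))

/-- By `gaussWeight_succ_mul`, the difference of the summands at `s` is `T (s + 1) - T s`, where `T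
m` is the right-hand side and `T 0 = 0`. -/
theorem sum_gaussWeight_telescope (n m : ℕ) :
    (1 - PowerSeries.X ^ (n + 1)) * ∑ s ∈ Finset.range m,
        (-1) ^ s * gaussWeight s * PowerSeries.X ^ (s * (n + 2)) -
      (1 + PowerSeries.X ^ (n + 1)) * ∑ s ∈ Finset.range m,
        (-1) ^ s * gaussWeight s * PowerSeries.X ^ (s * (n + 1)) =
    (-1) ^ m * PowerSeries.X ^ (m * (n + 1)) * gaussWeight m * (1 - PowerSeries.X ^ m) := by
  induction m with
  | zero => simp
  | succ m ih =>
    rw [Finset.sum_range_succ, Finset.sum_range_succ]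
    have h := gaussWeight_succ_mul m
    linear_combination ih - (-1) ^ (m + 1) * PowerSeries.X ^ ((m + 1) * (n + 1)) * h

/-- The finite form of Gauss's theta identity. -/
theorem thetaSum_mul_overpartitionProd (n : ℕ) :
    thetaSum n * overpartitionProd n = gaussThetaSum n := by
  induction n with
  | zero => simp [thetaSum, overpartitionProd, gaussThetaSum, gaussWeight]
  | succ n ih =>
    have h1 : (1 - PowerSeries.X ^ (n + 1)) * gaussThetaSum (n + 1) -
        (1 + PowerSeries.X ^ (n + 1)) * gaussThetaSum n =
        (-1) ^ (n + 1) * PowerSeries.X ^ ((n + 1) * (n + 1)) * (1 - PowerSeries.X ^ (n + 1)) *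
          (2 * overpartitionProd (n + 1)) := by
      rw [← one_add_X_pow_mul_gaussWeight, gaussThetaSum, Finset.sum_range_succ, gaussThetaSum]
      linear_combination sum_gaussWeight_telescope n (n + 1)
    refine mul_right_cancel₀ (one_sub_X_pow_ne_zero n) ?_
    have h2 : thetaSum (n + 1) =
        thetaSum n + 2 * (-1) ^ (n + 1) * PowerSeries.X ^ ((n + 1) ^ 2) := by
      rw [thetaSum, Finset.sum_range_succ, ← add_assoc, ← thetaSum]
    have h3 := overpartitionFactor_mul n
    rw [h2]
    rw [overpartitionProd_succ] at h1 ⊢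
    linear_combination thetaSum n * overpartitionProd n * h3 - h1 +
      (1 + PowerSeries.X ^ (n + 1)) * ih

theorem coeff_gaussThetaSum {m n : ℕ} (h : m ≤ n) :
    PowerSeries.coeff m (gaussThetaSum n) = PowerSeries.coeff m (1 : PowerSeries ℤ) := by
  rw [gaussThetaSum, Finset.sum_range_succ', map_add, map_sum, Finset.sum_eq_zero]
  · simp [gaussWeight]
  -- After the index shift the exponent is `(s + 1) * (n + 1) > m`, so only the constant term
  -- survives.
  · intro s _
    rw [PowerSeries.coeff_mul_X_pow', if_neg]
    nlinarith

/-- The theta series `∑ (-1) ^ j * X ^ (j ^ 2)`. -/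
noncomputable def thetaSeries : PowerSeries ℤ :=
  PowerSeries.rescale (-1) (PowerSeries.mk fun n => (Nat.card {x : ℤ // x.natAbs ^ 2 = n} : ℤ))

theorem card_int_sq_succ (j : ℕ) :
    Nat.card {x : ℤ // x.natAbs ^ 2 = (j + 1) ^ 2} = 2 := by
  have h : {x : ℤ | x.natAbs ^ 2 = (j + 1) ^ 2} = ({(j + 1 : ℤ), -(j + 1 : ℤ)} : Set ℤ) := by
    ext x
    rw [Set.mem_ofPred_eq, Nat.pow_left_injective two_ne_zero |>.eq_iff]
    simp only [Set.mem_insert_iff, Set.mem_singleton_iff]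
    omega
  change Nat.card ({x : ℤ | x.natAbs ^ 2 = (j + 1) ^ 2} : Set ℤ) = 2
  rw [h, Nat.card_coe_set_eq, Set.ncard_pair (by omega)]

theorem card_int_sq_eq_zero {m : ℕ} (h : ∀ j, j ^ 2 ≠ m) :
    Nat.card {x : ℤ // x.natAbs ^ 2 = m} = 0 := by
  have : IsEmpty {x : ℤ // x.natAbs ^ 2 = m} := ⟨fun x => h _ x.2⟩
  exact Nat.card_of_isEmpty

theorem coeff_thetaSum {m n : ℕ} (h : m ≤ n) :
    PowerSeries.coeff m (thetaSum n) = PowerSeries.coeff m thetaSeries := by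
  have h1 (j : ℕ) : PowerSeries.coeff m
      (2 * (-1) ^ (j + 1) * PowerSeries.X ^ ((j + 1) ^ 2) : PowerSeries ℤ) =
      if m = (j + 1) ^ 2 then 2 * (-1) ^ (j + 1) else 0 := by
    rw [show (2 * (-1) ^ (j + 1) : PowerSeries ℤ) = PowerSeries.C (2 * (-1) ^ (j + 1)) by simp,
      PowerSeries.coeff_C_mul, PowerSeries.coeff_X_pow]
    split_ifs <;> simp
  rw [thetaSum, thetaSeries, map_add, map_sum, PowerSeries.coeff_rescale, PowerSeries.coeff_mk]
  simp_rw [h1]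
  by_cases hm : ∃ j, j ^ 2 = m
  · obtain ⟨_ | j, rfl⟩ := hm
    · rw [Finset.sum_eq_zero fun j _ => if_neg (by positivity)]
      simp
    · rw [Finset.sum_eq_single_of_mem j]
      · rw [card_int_sq_succ, if_pos rfl, PowerSeries.coeff_one, if_neg (by positivity), pow_two,
          pow_mul]
        -- The rescaling produces the sign `(-1)^((j+1)^2)`, and a square has the parity of its
        -- root.
        have h2 : ((-1 : ℤ) ^ (j + 1)) ^ (j + 1) = (-1) ^ (j + 1) := by
          rcases Nat.even_or_odd (j + 1) with h | h
          · simp [h.neg_one_pow]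
          · simp [h.neg_one_pow]
        rw [h2]
        push_cast
        ring
      · rw [Finset.mem_range]
        nlinarith
      · intro i _ hi
        rw [if_neg]
        intro h
        exact hi (Nat.succ_injective (Nat.pow_left_injective two_ne_zero h).symm)
  · push Not at hm
    rw [card_int_sq_eq_zero hm, Finset.sum_eq_zero fun j _ => if_neg (hm _).symm,
      PowerSeries.coeff_one, if_neg (by rintro rfl; exact hm 0 rfl)]
    simp

open scoped PowerSeries.WithPiTopology in
/-- Gauss's theta identity, as an identity for the generating function of overpartitions. -/
theorem thetaSeries_mul_overpartitionSeries : thetaSeries * overpartitionSeries = 1 := by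
  have h1 : Filter.Tendsto thetaSum Filter.atTop (nhds thetaSeries) := by
    rw [PowerSeries.WithPiTopology.tendsto_iff_coeff_tendsto]
    exact fun m => tendsto_atTop_of_eventually_const (i₀ := m) fun n hn => coeff_thetaSum hn
  have h2 : Filter.Tendsto gaussThetaSum Filter.atTop (nhds 1) := by
    rw [PowerSeries.WithPiTopology.tendsto_iff_coeff_tendsto]
    exact fun m => tendsto_atTop_of_eventually_const (i₀ := m) fun n hn => coeff_gaussThetaSum hn
  refine tendsto_nhds_unique (h1.mul tendsto_overpartitionProd) ?_
  simp_rw [thetaSum_mul_overpartitionProd]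
  exact h2

/-- Jacobi's theorem on sums of eight squares. -/
theorem thetaSeries_pow_eight : thetaSeries ^ 8 = 1 + 16 * altCubeSeries := by
  have h1 := thetaSeries_mul_overpartitionSeries
  have h2 := altCubeSeries_mul_overpartitionSeries_pow
  have h3 : (thetaSeries * overpartitionSeries) ^ 8 = 1 := by rw [h1, one_pow]
  rw [mul_pow] at h3
  linear_combination (1 + 16 * altCubeSeries) * h3 - thetaSeries ^ 8 * h2

/-! ### Powers of generating functions count tuples -/

/-- The coefficients of the powers of a generating function count tuples of given total weight. -/
theorem coeff_mk_card_pow {A : Type*} (w : A → ℕ) [∀ n, Finite {a // w a = n}] (k n : ℕ) :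
    PowerSeries.coeff n ((PowerSeries.mk fun m => (Nat.card {a // w a = m} : ℤ)) ^ k) =
      Nat.card {x : Fin k → A // ∑ i, w (x i) = n} ∧
    Finite {x : Fin k → A // ∑ i, w (x i) = n} := by
  induction k generalizing n with
  | zero =>
    refine ⟨?_, inferInstance⟩
    rw [pow_zero, PowerSeries.coeff_one]
    rcases Nat.eq_zero_or_pos n with rfl | hn
    · simp
    · simp [hn.ne', hn.ne]
  | succ k ih =>
    -- Finiteness is carried through the induction because `Nat.card_sigma` needs finite fibres.
    have := fun n => (ih n).2
    let e : {x : Fin (k + 1) → A // ∑ i, w (x i) = n} ≃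
        Σ p : {p // p ∈ Finset.HasAntidiagonal.antidiagonal n},
          {x : Fin k → A // ∑ i, w (x i) = p.1.1} × {a // w a = p.1.2} :=
      { toFun x := ⟨⟨(∑ i : Fin k, w (x.1 i.succ), w (x.1 0)),
          Finset.HasAntidiagonal.mem_antidiagonal.2
            ((add_comm _ _).trans ((Fin.sum_univ_succ _).symm.trans x.2))⟩,
          ⟨fun i => x.1 i.succ, rfl⟩, ⟨x.1 0, rfl⟩⟩
        invFun z := ⟨Fin.cons z.2.2.1 z.2.1.1, by
          have h := Finset.HasAntidiagonal.mem_antidiagonal.1 z.1.2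
          rw [Fin.sum_univ_succ]
          simp only [Fin.cons_zero, Fin.cons_succ]
          rw [z.2.1.2, z.2.2.2, add_comm, h]⟩
        left_inv x := Subtype.ext (Fin.cons_self_tail x.1)
        right_inv := by
          rintro ⟨⟨⟨i, j⟩, h⟩, (x : {x : Fin k → A // ∑ i, w (x i) = i}), (a : {a // w a = j})⟩
          obtain ⟨x, rfl⟩ := x
          obtain ⟨a, rfl⟩ := a
          rfl }
    refine ⟨?_, Finite.of_equiv _ e.symm⟩
    rw [Nat.card_congr e, Nat.card_sigma, pow_succ, PowerSeries.coeff_mul]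
    push_cast
    rw [Finset.sum_coe_sort (Finset.HasAntidiagonal.antidiagonal n) fun p =>
      (Nat.card ({x : Fin k → A // ∑ i, w (x i) = p.1} × {a // w a = p.2}) : ℤ)]
    refine Finset.sum_congr rfl fun p _ => ?_
    rw [(ih _).1, PowerSeries.coeff_mk, Nat.card_prod]
    push_cast
    rfl

theorem coeff_overpartitionSeries_pow (k n : ℕ) :
    PowerSeries.coeff n (overpartitionSeries ^ k) = overpartitionCount k n := by
  have (m : ℕ) : Finite {s : Σ m : ℕ, Overpartition m // s.1 = m} :=
    Finite.of_equiv _ (Equiv.sigmaSubtype m).symm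
  rw [overpartitionCount, OverpartitionTuple,
    ← (coeff_mk_card_pow (A := Σ m : ℕ, Overpartition m) (fun s => s.1) k n).1,
    overpartitionSeries]
  simp_rw [fun m => Nat.card_congr (Equiv.sigmaSubtype (β := Overpartition) m)]

theorem coeff_thetaSeries_pow (k n : ℕ) :
    PowerSeries.coeff n (thetaSeries ^ k) = (-1) ^ n * sumSquaresCount k n := by
  have (m : ℕ) : Finite {x : ℤ // x.natAbs ^ 2 = m} := by
    refine (Set.finite_Icc (-(m : ℤ)) m).subset fun x (hx : x.natAbs ^ 2 = m) => ?_
    have : x.natAbs ≤ m := hx ▸ Nat.le_self_pow two_ne_zero _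
    rw [Set.mem_Icc]
    omega
  rw [thetaSeries, ← map_pow, PowerSeries.coeff_rescale,
    (coeff_mk_card_pow (fun x : ℤ => x.natAbs ^ 2) k n).1, sumSquaresCount, SquaresRep]
  congr 2
  refine Nat.card_congr (Equiv.subtypeEquivRight fun x => ?_)
  rw [← Nat.cast_inj (R := ℤ)]
  push_cast
  simp only [sq_abs]

/-! ### Reduction modulo a prime -/

/-- A divisor of `p * k` that does not divide `k` is a multiple of `p`, so its cube vanishes modulo
`p`. -/
theorem altCubeSum_mul_modEq {p : ℕ} (hp : p.Prime) (k : ℕ) :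
    (altCubeSum (p * k) : ZMod p) = altCubeSum k := by
  rcases Nat.eq_zero_or_pos k with rfl | hk
  · simp
  simp only [altCubeSum, Nat.sum_divisorsAntidiagonal fun d _ => (-1 : ℤ) ^ d * (d : ℤ) ^ 3]
  push_cast
  symm
  refine Finset.sum_subset (Nat.divisors_subset_of_dvd (by positivity [hp.pos])
    (Dvd.intro_left p rfl)) fun d hd hd' => ?_
  have h1 : p ∣ d := by
    by_contra h
    refine hd' (Nat.mem_divisors.2 ⟨?_, hk.ne'⟩)
    exact ((Nat.Prime.coprime_iff_not_dvd hp).2 h).symm.dvd_of_dvd_mul_left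
      (Nat.dvd_of_mem_divisors hd)
  rw [(ZMod.natCast_eq_zero_iff d p).2 h1]
  ring

/-- Series in `q^p` pass through the operator extracting the exponents divisible by `p`: a term
pairs with one of exponent divisible by `p` only if its own exponent is too. -/
theorem coeff_mul_expand_mul {R : Type*} [CommRing R] {p : ℕ} (hp : p ≠ 0)
    (f g : PowerSeries R) (n : ℕ) :
    PowerSeries.coeff (p * n) (f * PowerSeries.expand p hp g) =
      PowerSeries.coeff n (PowerSeries.mk (fun k => PowerSeries.coeff (p * k) f) * g) := by
  rw [PowerSeries.coeff_mul, PowerSeries.coeff_mul]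
  symm
  refine Finset.sum_of_injOn (fun z => (p * z.1, p * z.2)) ?_ ?_ ?_ ?_
  · rintro ⟨a, b⟩ _ ⟨c, d⟩ _ h
    simpa [hp] using h
  · rintro ⟨a, b⟩ h
    have h : a + b = n := by simpa using h
    simp [← h, mul_add]
  · rintro ⟨a, b⟩ h hnot
    have h := Finset.HasAntidiagonal.mem_antidiagonal.1 h
    rw [PowerSeries.coeff_expand_of_not_dvd, mul_zero]
    rintro ⟨d, rfl⟩
    obtain ⟨c, rfl⟩ := (Nat.dvd_add_left (Dvd.intro d rfl)).1 (h ▸ Dvd.intro n rfl)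
    refine hnot ⟨(c, d), ?_, rfl⟩
    have : p * (c + d) = p * n := by rw [mul_add]; exact h
    simpa [hp] using this
  · rintro ⟨a, b⟩ _
    simp

theorem pow_eq_expand_zmod (p : ℕ) [hp : Fact p.Prime] (f : PowerSeries (ZMod p)) :
    f ^ p = PowerSeries.expand p hp.out.ne_zero f := by
  have h := MvPowerSeries.map_frobenius_expand p hp.out.ne_zero (f := f)
  rw [ZMod.frobenius_zmod, MvPowerSeries.map_id] at h
  exact h.symm

theorem mainTheorem8 (n : ℕ) :
    (overpartitionCount 3 (11 * n) : ℤ) ≡ (-1) ^ n * (sumSquaresCount 7 n : ℤ) [ZMOD 11] := by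
  have : Fact (Nat.Prime 11) := ⟨by norm_num⟩
  rw [← coeff_overpartitionSeries_pow, ← coeff_thetaSeries_pow]
  refine (ZMod.intCast_eq_intCast_iff _ _ 11).1 ?_
  have h1 := thetaSeries_mul_overpartitionSeries
  have h2 : overpartitionSeries ^ 3 = thetaSeries ^ 8 * overpartitionSeries ^ 11 := by
    have h : (thetaSeries * overpartitionSeries) ^ 8 = 1 := by rw [h1, one_pow]
    rw [mul_pow] at h
    linear_combination (-overpartitionSeries ^ 3) * h
  have h3 : thetaSeries ^ 7 = thetaSeries ^ 8 * overpartitionSeries := by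
    linear_combination (-thetaSeries ^ 7) * h1
  let φ := PowerSeries.map (Int.castRingHom (ZMod 11))
  have hφ (m : ℕ) (f : PowerSeries ℤ) :
      ((PowerSeries.coeff m f : ℤ) : ZMod 11) = PowerSeries.coeff m (φ f) := by
    simp [φ]
  -- Modulo 11, `θ^8` is fixed by extraction of the exponents divisible by 11.
  have h4 : PowerSeries.mk (fun k => PowerSeries.coeff (11 * k) (φ (thetaSeries ^ 8))) =
      φ (thetaSeries ^ 8) := by
    ext k
    rw [PowerSeries.coeff_mk, ← hφ, ← hφ, thetaSeries_pow_eight,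
      show (16 : PowerSeries ℤ) = PowerSeries.C 16 by simp, map_add, map_add,
      PowerSeries.coeff_C_mul, PowerSeries.coeff_C_mul, altCubeSeries, PowerSeries.coeff_mk,
      PowerSeries.coeff_mk, PowerSeries.coeff_one, PowerSeries.coeff_one]
    push_cast
    rw [altCubeSum_mul_modEq this.out]
    simp
  rw [h2, h3, hφ, hφ, map_mul φ, map_mul φ, map_pow φ overpartitionSeries, pow_eq_expand_zmod,
    coeff_mul_expand_mul, h4]
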